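/- Let $d\ge 0$ be an integer, and let $E=E(u,v):\mathbb R^d\times\mathbb R^d\to\mathbb R$, $S:\mathbb R^d\to\mathbb R^d$, $K:\mathbb R\to\mathbb R^{d\times d}$, $\Gamma:\mathbb R^d\to\mathbb R^{d\times d}$ and $c\in\mathbb R$, $c\neq 0$. Put $R=1$ if $\nabla_vE\equiv 0$, and $R=2$ otherwise. Assume: (K) $K(-r)=K(r)=K(r)^T$ for almost every $r$, $K$ is integrable, and $\int_{\mathbb R}(1+|r|)\,\|K(r)\|\,dr<\infty$; (G) $E$ and $S$ are of class $C^{R+1}$; and either $\nabla_vE(u,v)=0$ for all $u,v$, or the Hessian $\nabla_v^2E(u,v)$ is invertible for all $u,v$; ($\Gamma$) $\Gamma$ is continuous and bounded, and $\Gamma(p)$ is positive definite for every $p\in\mathbb R^d$, in the sense that $\Gamma(p)w\cdot w>0$ for all $w\ne0$ (symmetry is not required). Let $u:\mathbb R\to\mathbb R^d$ be a function of class $C^R$ whose derivatives of order $0,\dots,R-1$ are bounded on $\mathbb R$, and which satisfies on $\mathbb R$ the equation $$-\partial_x\nabla_vE(u,u')+\nabla_uE(u,u')+DS(u)^T\,\bigl(K*S(u)\bigr)=c\,\Gamma(u)\,u',\qquad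 (K*f)(x)=\int_{\mathbb R}K(x-y)f(y)\,dy .$$ Let $C^R_{\mathrm{loc}}(\mathbb R,\mathbb R^d)$ be the space of $C^R$ functions $\mathbb R\to\mathbb R^d$ with the topology of uniform convergence on compact sets of all derivatives of order at most $R$, let $(\phi_\tau u)(x)=u(x+\tau)$, and let $$\alpha(u)=\bigcap_{T\in\mathbb R}\overline{\{\phi_\tau u:\tau\le T\}},\qquad \omega(u)=\bigcap_{T\in\mathbb R}\overline{\{\phi_\tau u:\tau\ge T\}}$$ (closures in $C^R_{\mathrm{loc}}$) be the $\alpha$- and $\omega$-limit sets of $u$ under the shift. Then $\alpha(u)$ and $\omega(u)$ are both nonempty and consist only of constant functions. Moreover, if $u$ is not constant, then $\alpha(u)\cap\omega(u)=\emptyset$. -/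

import Mathlib

open MeasureTheory Filter Topology

noncomputable section

namespace GradLike

/-- The state space `ℝ^d` with its Euclidean inner product. The algebra of `d × d` matrices is
represented by the linear endomorphisms `Vec d →L[ℝ] Vec d`, transposition by the adjoint. -/
abbrev Vec (d : ℕ) : Type := EuclideanSpace ℝ (Fin d)

/-! ### The space `C^k_loc` and the shift -/

/-- The functions `ℝ → ℝ^d` of class `C^k`. -/
def CkLoc (d k : ℕ) : Type := {u : ℝ → Vec d // ContDiff ℝ (k : WithTop ℕ∞) u}

namespace CkLoc

variable {d k : ℕ}

instance : CoeFun (CkLoc d k) (fun _ => ℝ → Vec d) := ⟨fun u => u.1⟩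

/-- The derivatives of order `0, …, k`, as continuous functions on `ℝ`. -/
def jet (u : CkLoc d k) (j : Fin (k + 1)) : C(ℝ, Vec d) where
  toFun := iteratedDeriv j u
  continuous_toFun :=
    u.2.continuous_iteratedDeriv j (by exact_mod_cast Nat.lt_succ_iff.mp j.2)

/-- The topology of `C^k_loc`: uniform convergence on compact sets of all derivatives of
order at most `k` (`C(ℝ, ℝ^d)` carries the compact-open topology). -/
instance : TopologicalSpace (CkLoc d k) := TopologicalSpace.induced jet inferInstance

/-- The shift `(φ_τ u)(x) = u (x + τ)`. -/
def shift (τ : ℝ) (u : CkLoc d k) : CkLoc d k :=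
  ⟨fun x => u (x + τ), u.2.comp (contDiff_id.add contDiff_const)⟩

/-- The `α`-limit set of `N` under the shift: the intersection over the neighbourhoods `T` of `-∞`
of the closures of `{φ_τ u | τ ∈ T, u ∈ N}`. -/
def alphaLimit (N : Set (CkLoc d k)) : Set (CkLoc d k) := omegaLimit atBot shift N

/-- The `ω`-limit set of `N` under the shift: the intersection over the neighbourhoods `T` of `+∞`
of the closures of `{φ_τ u | τ ∈ T, u ∈ N}`. -/
def omegaLimitSet (N : Set (CkLoc d k)) : Set (CkLoc d k) := omegaLimit atTop shift N

/-- `u` is a constant function. -/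
def IsConst (u : CkLoc d k) : Prop := ∃ p : Vec d, ∀ x, u x = p

/-- All derivatives of `u` of order at most `m` are bounded on `ℝ`. -/
def BoundedUpTo (m : ℕ) (u : CkLoc d k) : Prop :=
  ∀ j ≤ m, ∃ C : ℝ, ∀ x, ‖iteratedDeriv j u x‖ ≤ C

end CkLoc

/-! ### The Lagrangian data -/

variable {d : ℕ}

/-- The partial gradient `∇_u E (p, q)` of `E = E (u, v)`. -/
def gradU (E : Vec d × Vec d → ℝ) (p q : Vec d) : Vec d := gradient (fun p' => E (p', q)) p

/-- The partial gradient `∇_v E (p, q)` of `E = E (u, v)`. -/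
def gradV (E : Vec d × Vec d → ℝ) (p q : Vec d) : Vec d := gradient (fun q' => E (p, q')) q

/-- The partial Hessian `∇_v² E (p, q)` of `E = E (u, v)`. -/
def hessV (E : Vec d × Vec d → ℝ) (p q : Vec d) : Vec d →L[ℝ] Vec d :=
  fderiv ℝ (fun q' => gradV E p q') q

open Classical in
/-- The regularity index `R` of solutions: `1` if `∇_v E` vanishes identically, `2` otherwise. -/
def regularity (E : Vec d × Vec d → ℝ) : ℕ := if ∀ p q, gradV E p q = 0 then 1 else 2

/-- The kernel is symmetric, integrable, and has an integrable first moment. As `K` is an element of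
`L¹`, the symmetries are required almost everywhere. -/
structure HypothesisK (K : ℝ → Vec d →L[ℝ] Vec d) : Prop where
  even : ∀ᵐ r, K (-r) = K r
  symm : ∀ᵐ r, ContinuousLinearMap.adjoint (K r) = K r
  integrable : Integrable K
  moment : Integrable fun r => (1 + |r|) * ‖K r‖

/-- `E` and `S` are of class `C^{R+1}`; either `∇_v E` vanishes identically, or `∇_v² E` is
invertible everywhere. -/
structure HypothesisG (E : Vec d × Vec d → ℝ) (S : Vec d → Vec d) : Prop where
  smooth_E : ContDiff ℝ ((regularity E + 1 : ℕ) : WithTop ℕ∞) E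
  smooth_S : ContDiff ℝ ((regularity E + 1 : ℕ) : WithTop ℕ∞) S
  nondegenerate : (∀ p q, gradV E p q = 0) ∨ (∀ p q, IsUnit (hessV E p q))

/-- `Γ` is continuous and bounded, with positive definite values (symmetry of `Γ p` is not
required). -/
structure HypothesisGamma (Γ : Vec d → Vec d →L[ℝ] Vec d) : Prop where
  continuous : Continuous Γ
  bounded : ∃ C : ℝ, ∀ p, ‖Γ p‖ ≤ C
  posDef : ∀ p w, w ≠ 0 → 0 < inner ℝ (Γ p w) w

/-- The convolution `(K * f)(x) = ∫ K(x - y) f(y) dy`. -/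
def conv (K : ℝ → Vec d →L[ℝ] Vec d) (f : ℝ → Vec d) (x : ℝ) : Vec d := ∫ y, K (x - y) (f y)

/-- `u` solves `-∂_x ∇_v E(u,u') + ∇_u E(u,u') + DS(u)ᵀ (K * S(u)) = c Γ(u) u'` on `ℝ`. -/
def IsSolution (E : Vec d × Vec d → ℝ) (S : Vec d → Vec d) (K : ℝ → Vec d →L[ℝ] Vec d)
    (Γ : Vec d → Vec d →L[ℝ] Vec d) (c : ℝ) (u : ℝ → Vec d) : Prop :=
  ∀ x, -deriv (fun z => gradV E (u z) (deriv u z)) x + gradU E (u x) (deriv u x)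
      + ContinuousLinearMap.adjoint (fderiv ℝ S (u x)) (conv K (fun y => S (u y)) x)
    = c • Γ (u x) (deriv u x)

end GradLike

end

/-! Testing the equation with `u'` produces a Lyapunov function. The local terms are the derivative
of `E - ⟪∇_v E, u'⟫`, and the nonlocal term `⟪K * f, f'⟫` with `f = S ∘ u` has an explicit primitive
(`hasDerivAt_nonlocalEnergy`), finite because `K` has a first moment. Hence `H' = c ⟪Γ(u) u', u'⟫`
(`hasDerivAt_lyapunov`), so `c * H` is nondecreasing; it is bounded, and `H` converges at both ends.

Solving the equation for the highest derivative bounds it and makes it uniformly continuous, so an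
Ascoli argument (`exists_mapClusterPt_shift`) gives nonempty limit sets. Along translates converging
to `v`, the increment of `H` over a unit window tends to `0`, so `⟪Γ(v) v', v'⟫` vanishes and `v` is
constant. At a constant `p` the limit of `H` depends on `p` alone. A common point of both limit sets
therefore forces equal limits of `H` at `±∞`; then `H` is constant, and so is `u`. -/

namespace GradLike

/-! ### A primitive of the nonlocal term. -/

/-- The density, at interaction range `r` and for the interaction matrix `A`, of a primitive
of `⟪K * f, f'⟫`. -/
noncomputable def nonlocalDensity {d : ℕ} (A : Vec d →L[ℝ] Vec d) (f : ℝ → Vec d) (r x : ℝ) : ℝ :=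
  inner ℝ (A (f (x - r))) (f x)
    + ∫ t in (0 : ℝ)..r, inner ℝ (A (f (x - t + r))) (deriv f (x - t))

/-- A primitive of `⟪K * f, f'⟫`. -/
noncomputable def nonlocalEnergy {d : ℕ} (K : ℝ → Vec d →L[ℝ] Vec d) (f : ℝ → Vec d) (x : ℝ) : ℝ :=
  (1 / 2) * ∫ r, nonlocalDensity (K r) f r x

section Nonlocal

variable {d : ℕ} {K : ℝ → Vec d →L[ℝ] Vec d} {f : ℝ → Vec d} {M M' : ℝ}

/-- The `t`-integral runs over a window of length `r` moving with `x`, so its derivative is a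
difference of end values. Self-adjointness of `A` makes the value at `x - r` cancel the term in
which the shifted factor `f (x - r)` is differentiated. -/
theorem hasDerivAt_nonlocalDensity (hf : ContDiff ℝ 1 f) {A : Vec d →L[ℝ] Vec d}
    (hA : ContinuousLinearMap.adjoint A = A) (r x : ℝ) :
    HasDerivAt (nonlocalDensity A f r)
      (inner ℝ (A (f (x - r))) (deriv f x) + inner ℝ (A (f (x + r))) (deriv f x)) x := by
  have hfc : Continuous f := hf.continuous
  have hfc' : Continuous (deriv f) := hf.continuous_deriv le_rfl
  have hd : ∀ y, HasDerivAt f (deriv f y) y := fun y =>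
    (hf.differentiable one_ne_zero y).hasDerivAt
  set g : ℝ → ℝ := fun s => inner ℝ (A (f (s + r))) (deriv f s) with hg
  have hgc : Continuous g := by fun_prop
  have h1 : HasDerivAt (fun x => inner ℝ (A (f (x - r))) (f x))
      (inner ℝ (A (f (x - r))) (deriv f x) + inner ℝ (A (deriv f (x - r))) (f x)) x := by
    have hAf : HasDerivAt (fun x => A (f (x - r))) (A (deriv f (x - r))) x :=
      A.hasFDerivAt.comp_hasDerivAt x ((hd (x - r)).comp_sub_const x r)
    exact hAf.inner ℝ (hd x)
  have h2 : HasDerivAt (fun x => ∫ t in (0 : ℝ)..r, g (x - t)) (g x - g (x - r)) x := by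
    have e : (fun x => ∫ t in (0 : ℝ)..r, g (x - t))
        = fun x => (∫ s in (0 : ℝ)..x, g s) - ∫ s in (0 : ℝ)..(x - r), g s := by
      funext x
      rw [intervalIntegral.integral_comp_sub_left, sub_zero,
        intervalIntegral.integral_interval_sub_left (hgc.intervalIntegrable _ _)
          (hgc.intervalIntegrable _ _)]
    rw [e]
    have hp : ∀ y, HasDerivAt (fun x => ∫ s in (0 : ℝ)..x, g s) (g y) y := fun y =>
      intervalIntegral.integral_hasDerivAt_right (hgc.intervalIntegrable _ _)
        (hgc.stronglyMeasurableAtFilter _ _) hgc.continuousAt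
    exact (hp x).sub ((hp (x - r)).comp_sub_const x r)
  refine (h1.add h2).congr_deriv ?_
  have h3 : inner ℝ (A (deriv f (x - r))) (f x) = inner ℝ (A (f x)) (deriv f (x - r)) := by
    conv_lhs => rw [← hA, ContinuousLinearMap.adjoint_inner_left, real_inner_comm]
  simp only [hg, sub_add_cancel, h3]
  ring

theorem abs_inner_clm_le {A : Vec d →L[ℝ] Vec d} {a b : Vec d} (ha : ‖a‖ ≤ M) (hb : ‖b‖ ≤ M') :
    ‖inner ℝ (A a) b‖ ≤ ‖A‖ * M * M' := by
  have hM : 0 ≤ M := (norm_nonneg _).trans ha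
  calc ‖inner ℝ (A a) b‖ ≤ ‖A a‖ * ‖b‖ := norm_inner_le_norm _ _
    _ ≤ (‖A‖ * M) * M' := by
      gcongr
      exact A.le_opNorm_of_le ha

/-- The factor `|r|` is the length of the `t`-interval; this is where the first moment of `K`
enters. -/
theorem norm_nonlocalDensity_le (hM : ∀ x, ‖f x‖ ≤ M) (hM' : ∀ x, ‖deriv f x‖ ≤ M')
    (A : Vec d →L[ℝ] Vec d) (r x : ℝ) :
    ‖nonlocalDensity A f r x‖ ≤ (M * M + M * M') * ((1 + |r|) * ‖A‖) := by
  have h0 : 0 ≤ M := (norm_nonneg _).trans (hM 0)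
  have h0' : 0 ≤ M' := (norm_nonneg _).trans (hM' 0)
  have h1 : ‖inner ℝ (A (f (x - r))) (f x)‖ ≤ ‖A‖ * M * M := abs_inner_clm_le (hM _) (hM _)
  have h2 : ‖∫ t in (0 : ℝ)..r, inner ℝ (A (f (x - t + r))) (deriv f (x - t))‖
      ≤ ‖A‖ * M * M' * |r - 0| :=
    intervalIntegral.norm_integral_le_of_norm_le_const fun t _ => abs_inner_clm_le (hM _) (hM' _)
  rw [sub_zero] at h2
  refine (norm_add_le _ _).trans ((add_le_add h1 h2).trans ?_)
  have hA := norm_nonneg A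
  have hr := abs_nonneg r
  have : (M * M + M * M') * ((1 + |r|) * ‖A‖) - (‖A‖ * M * M + ‖A‖ * M * M' * |r|)
    = ‖A‖ * (M * M * |r|) + ‖A‖ * (M * M') := by ring
  have h3 : 0 ≤ ‖A‖ * (M * M * |r|) + ‖A‖ * (M * M') := by positivity
  linarith

/-- Joint continuity in range and matrix lets the merely measurable `K` be substituted for the
matrix. -/
theorem continuous_nonlocalDensity (hf : ContDiff ℝ 1 f) (x : ℝ) :
    Continuous fun q : ℝ × (Vec d →L[ℝ] Vec d) => nonlocalDensity q.2 f q.1 x := by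
  have hfc : Continuous f := hf.continuous
  have hfc' : Continuous (deriv f) := hf.continuous_deriv le_rfl
  have h1 : Continuous fun q : ℝ × (Vec d →L[ℝ] Vec d) => inner ℝ (q.2 (f (x - q.1))) (f x) := by
    fun_prop
  have h2 : Continuous fun p : (ℝ × (Vec d →L[ℝ] Vec d)) × ℝ =>
      inner ℝ (p.1.2 (f (x - p.2 + p.1.1))) (deriv f (x - p.2)) := by
    fun_prop
  exact h1.add
    (intervalIntegral.continuous_parametric_intervalIntegral_of_continuous h2 continuous_fst)

theorem aestronglyMeasurable_nonlocalDensity (hf : ContDiff ℝ 1 f) (hK : HypothesisK K) (x : ℝ) :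
    AEStronglyMeasurable (fun r => nonlocalDensity (K r) f r x) volume := by
  have hm : AEStronglyMeasurable (fun r : ℝ => (r, K r)) volume :=
    AEStronglyMeasurable.prodMk continuous_id.aestronglyMeasurable
      hK.integrable.aestronglyMeasurable
  have hc := continuous_nonlocalDensity hf x
  generalize hF : (fun q : ℝ × (Vec d →L[ℝ] Vec d) => nonlocalDensity q.2 f q.1 x) = F at hc
  have he : (fun r => nonlocalDensity (K r) f r x) = fun r => F (r, K r) := by rw [← hF]
  rw [he]
  exact hc.comp_aestronglyMeasurable hm

theorem integrable_nonlocalDensity (hf : ContDiff ℝ 1 f) (hM : ∀ x, ‖f x‖ ≤ M)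
    (hM' : ∀ x, ‖deriv f x‖ ≤ M') (hK : HypothesisK K) (x : ℝ) :
    Integrable fun r => nonlocalDensity (K r) f r x :=
  by
  have h := hK.moment.const_mul (M * M + M * M')
  refine h.mono' (aestronglyMeasurable_nonlocalDensity hf hK x) (ae_of_all _ fun r => ?_)
  exact norm_nonlocalDensity_le hM hM' (K r) r x

theorem abs_nonlocalEnergy_le (hM : ∀ x, ‖f x‖ ≤ M)
    (hM' : ∀ x, ‖deriv f x‖ ≤ M') (hK : HypothesisK K) (x : ℝ) :
    |nonlocalEnergy K f x| ≤
      1 / 2 * ∫ r, (M * M + M * M') * ((1 + |r|) * ‖K r‖) := by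
  have h : |∫ r, nonlocalDensity (K r) f r x|
      ≤ ∫ r, (M * M + M * M') * ((1 + |r|) * ‖K r‖) :=
    norm_integral_le_of_norm_le (hK.moment.const_mul (M * M + M * M'))
      (ae_of_all _ fun r => norm_nonlocalDensity_le hM hM' (K r) r x)
  rw [nonlocalEnergy, abs_mul, abs_of_pos one_half_pos]
  exact mul_le_mul_of_nonneg_left h one_half_pos.le

theorem conv_eq_integral_sub (K : ℝ → Vec d →L[ℝ] Vec d) (f : ℝ → Vec d) (x : ℝ) :
    conv K f x = ∫ r, K r (f (x - r)) := by
  rw [conv, ← integral_sub_left_eq_self _ volume x]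
  simp

theorem integrable_clm_apply (hK : Integrable K) {g : ℝ → Vec d} (hg : Continuous g)
    (hM : ∀ x, ‖g x‖ ≤ M) : Integrable fun r => K r (g r) := by
  refine (hK.norm.mul_const M).mono' ?_ (ae_of_all _ fun r => (K r).le_opNorm_of_le (hM r))
  have hc : Continuous fun q : (Vec d →L[ℝ] Vec d) × ℝ => q.1 (g q.2) := by fun_prop
  exact hc.comp_aestronglyMeasurable (hK.aestronglyMeasurable.prodMk aestronglyMeasurable_id)

theorem integral_clm_reflect (hK : HypothesisK K) (f : ℝ → Vec d) (x : ℝ) :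
    ∫ r, K r (f (x + r)) = conv K f x := by
  rw [conv_eq_integral_sub, ← integral_neg_eq_self]
  refine integral_congr_ae ?_
  filter_upwards [hK.even] with r hr
  rw [hr, sub_eq_add_neg]

/-- Differentiation under the integral, dominated by a multiple of `‖K r‖`. By evenness of `K` the
terms with `x - r` and `x + r` both integrate to `⟪K * f, f'⟫`, which accounts for the factor `1/2`.
-/
theorem hasDerivAt_nonlocalEnergy (hf : ContDiff ℝ 1 f) (hM : ∀ x, ‖f x‖ ≤ M)
    (hM' : ∀ x, ‖deriv f x‖ ≤ M') (hK : HypothesisK K) (x : ℝ) :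
    HasDerivAt (nonlocalEnergy K f) (inner ℝ (conv K f x) (deriv f x)) x := by
  have hfc : Continuous f := hf.continuous
  have i1 : Integrable fun r => K r (f (x - r)) :=
    integrable_clm_apply hK.integrable (by fun_prop) fun r => hM _
  have i2 : Integrable fun r => K r (f (x + r)) :=
    integrable_clm_apply hK.integrable (by fun_prop) fun r => hM _
  have key := hasDerivAt_integral_of_dominated_loc_of_deriv_le (μ := volume) (x₀ := x)
    (F := fun x r => nonlocalDensity (K r) f r x)
    (F' := fun x r => inner ℝ (K r (f (x - r))) (deriv f x) + inner ℝ (K r (f (x + r))) (deriv f x))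
    (bound := fun r => ‖K r‖ * (2 * (M * M'))) univ_mem
    (Eventually.of_forall fun y => aestronglyMeasurable_nonlocalDensity hf hK y)
    (integrable_nonlocalDensity hf hM hM' hK x)
    ((i1.inner_const _).add (i2.inner_const _)).aestronglyMeasurable
    (ae_of_all _ fun r y _ => by
      refine (norm_add_le _ _).trans ((add_le_add (abs_inner_clm_le (hM _) (hM' _))
        (abs_inner_clm_le (hM _) (hM' _))).trans (le_of_eq (by ring))))
    (hK.integrable.norm.mul_const _)
    (by
      filter_upwards [hK.symm] with r hr y _
      exact hasDerivAt_nonlocalDensity hf hr r y)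
  refine (key.2.const_mul (1 / 2)).congr_deriv ?_
  have e1 : ∫ r, inner ℝ (K r (f (x - r))) (deriv f x) = inner ℝ (conv K f x) (deriv f x) := by
    rw [conv_eq_integral_sub]
    simp_rw [real_inner_comm (deriv f x)]
    exact integral_inner i1 _
  have e2 : ∫ r, inner ℝ (K r (f (x + r))) (deriv f x) = inner ℝ (conv K f x) (deriv f x) := by
    rw [← integral_clm_reflect hK]
    simp_rw [real_inner_comm (deriv f x)]
    exact integral_inner i2 _
  rw [integral_add (i1.inner_const _) (i2.inner_const _), e1, e2]
  ring

/-- Dominated convergence, hence the countably generated filter. The inner `t`-integral disappears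
in the limit because `f'` tends to `0`. -/
theorem tendsto_nonlocalEnergy (hf : ContDiff ℝ 1 f) (hM : ∀ x, ‖f x‖ ≤ M)
    (hM' : ∀ x, ‖deriv f x‖ ≤ M') (hK : HypothesisK K) {l : Filter ℝ} [l.IsCountablyGenerated]
    {s : Vec d} (h : ∀ x, Tendsto (fun τ => f (x + τ)) l (𝓝 s))
    (h' : ∀ x, Tendsto (fun τ => deriv f (x + τ)) l (𝓝 0)) :
    Tendsto (nonlocalEnergy K f) l (𝓝 (1 / 2 * ∫ r, inner ℝ (K r s) s)) := by
  have hfc : Continuous f := hf.continuous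
  have hfc' : Continuous (deriv f) := hf.continuous_deriv le_rfl
  refine Tendsto.const_mul _ ?_
  refine tendsto_integral_filter_of_dominated_convergence
    (fun r => (M * M + M * M') * ((1 + |r|) * ‖K r‖))
    (Eventually.of_forall fun y => aestronglyMeasurable_nonlocalDensity hf hK y)
    (Eventually.of_forall fun y => ae_of_all _ fun r =>
      norm_nonlocalDensity_le hM hM' (K r) r y)
    (hK.moment.const_mul _) (ae_of_all _ fun r => ?_)
  have h1 : Tendsto (fun τ => inner ℝ (K r (f (τ - r))) (f τ)) l (𝓝 (inner ℝ (K r s) s)) := by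
    refine Tendsto.inner (((K r).continuous.tendsto s).comp ?_) ?_
    · refine (h (-r)).congr fun τ => ?_
      rw [neg_add_eq_sub]
    · simpa using h 0
  have h2 : Tendsto (fun τ => ∫ t in (0 : ℝ)..r, inner ℝ (K r (f (τ - t + r))) (deriv f (τ - t))) l
      (𝓝 (∫ t in (0 : ℝ)..r, inner ℝ (K r s) (0 : Vec d))) := by
    refine intervalIntegral.tendsto_integral_filter_of_dominated_convergence
      (fun _ => ‖K r‖ * M * M')
      (Eventually.of_forall fun y => Continuous.aestronglyMeasurable (by fun_prop))
      (Eventually.of_forall fun y => ae_of_all _ fun t _ => abs_inner_clm_le (hM _) (hM' _))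
      intervalIntegrable_const (ae_of_all _ fun t _ => ?_)
    refine Tendsto.inner (((K r).continuous.tendsto s).comp ?_) ?_
    · refine (h (r - t)).congr fun τ => ?_
      congr 1; ring
    · refine (h' (-t)).congr fun τ => ?_
      rw [neg_add_eq_sub]
  simpa [nonlocalDensity] using h1.add h2

end Nonlocal

/-! ### Bounds and uniform continuity of convolutions. -/

section Conv

variable {d : ℕ} {K : ℝ → Vec d →L[ℝ] Vec d} {f : ℝ → Vec d} {M M' : ℝ}

theorem norm_conv_le (hM : ∀ x, ‖f x‖ ≤ M) (hK : Integrable K) (x : ℝ) :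
    ‖conv K f x‖ ≤ ∫ r, ‖K r‖ * M := by
  rw [conv_eq_integral_sub]
  exact norm_integral_le_of_norm_le (hK.norm.mul_const M)
    (ae_of_all _ fun r => (K r).le_opNorm_of_le (hM _))

/-- With the translation moved onto `f`, the convolution inherits the Lipschitz bound `M'` times the
integral of `‖K‖`. -/
theorem uniformContinuous_conv (hf : Differentiable ℝ f) (hM : ∀ x, ‖f x‖ ≤ M)
    (hM' : ∀ x, ‖deriv f x‖ ≤ M') (hK : Integrable K) : UniformContinuous (conv K f) := by
  have h0 : 0 ≤ M' := (norm_nonneg _).trans (hM' 0)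
  have hfc : Continuous f := hf.continuous
  have hlip : ∀ x y, ‖f x - f y‖ ≤ M' * ‖x - y‖ := fun x y =>
    convex_univ.norm_image_sub_le_of_norm_deriv_le (fun z _ => hf z) (fun z _ => hM' z)
      (Set.mem_univ y) (Set.mem_univ x)
  have key : LipschitzWith (Real.toNNReal ((∫ r, ‖K r‖) * M')) (conv K f) := by
    refine LipschitzWith.of_dist_le' fun x y => ?_
    have i1 : ∀ x, Integrable fun r => K r (f (x - r)) := fun x =>
      integrable_clm_apply hK (by fun_prop) fun r => hM _
    rw [dist_eq_norm, dist_eq_norm, conv_eq_integral_sub, conv_eq_integral_sub,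
      ← integral_sub (i1 x) (i1 y), mul_assoc, ← integral_mul_const]
    refine norm_integral_le_of_norm_le (hK.norm.mul_const _) (ae_of_all _ fun r => ?_)
    rw [← map_sub]
    refine (K r).le_opNorm_of_le ((hlip _ _).trans_eq ?_)
    congr 2; ring
  exact key.uniformContinuous

end Conv

/-! ### Continuous functions along bounded curves. -/

section Bounded

variable {α X Y : Type*} [SeminormedAddCommGroup X] [ProperSpace X] [SeminormedAddCommGroup Y]
  {F : X → Y} {w : α → X} {M : ℝ}

theorem exists_norm_comp_le (hF : Continuous F) (hw : ∀ x, ‖w x‖ ≤ M) :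
    ∃ C, ∀ x, ‖F (w x)‖ ≤ C := by
  obtain ⟨C, hC⟩ := (isCompact_closedBall (0 : X) M).exists_bound_of_continuousOn hF.continuousOn
  exact ⟨C, fun x => hC _ (by simpa using hw x)⟩

theorem uniformContinuous_comp_of_bounded [UniformSpace α] (hF : Continuous F)
    (hw : ∀ x, ‖w x‖ ≤ M) (hu : UniformContinuous w) : UniformContinuous fun x => F (w x) := by
  have h := (isCompact_closedBall (0 : X) M).uniformContinuousOn_of_continuous hF.continuousOn
  exact uniformContinuousOn_univ.mp
    (h.comp hu.uniformContinuousOn fun x _ => by simpa using hw x)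

theorem uniformContinuous_of_norm_deriv_le {G : Type*} [NormedAddCommGroup G] [NormedSpace ℝ G]
    {f : ℝ → G} (hf : Differentiable ℝ f) {C : ℝ}
    (hC : ∀ x, ‖deriv f x‖ ≤ C) : UniformContinuous f := by
  have key : LipschitzWith (Real.toNNReal C) f := LipschitzWith.of_dist_le' fun x y => by
    rw [dist_eq_norm, dist_eq_norm]
    exact convex_univ.norm_image_sub_le_of_norm_deriv_le (fun z _ => hf z) (fun z _ => hC z)
      (Set.mem_univ y) (Set.mem_univ x)
  exact key.uniformContinuous

end Bounded

/-! ### Calculus of the Lagrangian and the local energy identity. -/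

section Lagrangian

variable {d : ℕ} {E : Vec d × Vec d → ℝ} {S : Vec d → Vec d}

theorem gradV_eq (hE : ContDiff ℝ 2 E) (p q : Vec d) :
    gradV E p q = (InnerProductSpace.toDual ℝ (Vec d)).symm
      ((fderiv ℝ E (p, q)).comp (ContinuousLinearMap.inr ℝ (Vec d) (Vec d))) := by
  have h : HasFDerivAt (fun q' => E (p, q'))
      ((fderiv ℝ E (p, q)).comp (ContinuousLinearMap.inr ℝ (Vec d) (Vec d))) q :=
    (hE.differentiable two_ne_zero (p, q)).hasFDerivAt.comp q (hasFDerivAt_prodMk_right p q)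
  rw [gradV, gradient, h.fderiv]

theorem gradU_eq (hE : ContDiff ℝ 2 E) (p q : Vec d) :
    gradU E p q = (InnerProductSpace.toDual ℝ (Vec d)).symm
      ((fderiv ℝ E (p, q)).comp (ContinuousLinearMap.inl ℝ (Vec d) (Vec d))) := by
  have h : HasFDerivAt (fun p' => E (p', q))
      ((fderiv ℝ E (p, q)).comp (ContinuousLinearMap.inl ℝ (Vec d) (Vec d))) p :=
    (hE.differentiable two_ne_zero (p, q)).hasFDerivAt.comp p (hasFDerivAt_prodMk_left p q)
  rw [gradU, gradient, h.fderiv]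

theorem inner_gradV (hE : ContDiff ℝ 2 E) (p q w : Vec d) :
    inner ℝ (gradV E p q) w = fderiv ℝ E (p, q) (0, w) := by
  rw [gradV_eq hE, InnerProductSpace.toDual_symm_apply]
  simp

theorem inner_gradU (hE : ContDiff ℝ 2 E) (p q w : Vec d) :
    inner ℝ (gradU E p q) w = fderiv ℝ E (p, q) (w, 0) := by
  rw [gradU_eq hE, InnerProductSpace.toDual_symm_apply]
  simp

theorem contDiff_gradV (hE : ContDiff ℝ 2 E) :
    ContDiff ℝ 1 fun z : Vec d × Vec d => gradV E z.1 z.2 := by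
  have h : ContDiff ℝ 1 (fderiv ℝ E) := hE.fderiv_right (by norm_num)
  have e : (fun z : Vec d × Vec d => gradV E z.1 z.2) = fun z =>
      (InnerProductSpace.toDual ℝ (Vec d)).symm
        ((fderiv ℝ E z).comp (ContinuousLinearMap.inr ℝ (Vec d) (Vec d))) := by
    funext z
    exact gradV_eq hE z.1 z.2
  rw [e]
  exact (InnerProductSpace.toDual ℝ (Vec d)).symm.toContinuousLinearEquiv.contDiff.comp
    (h.clm_comp contDiff_const)

theorem continuous_gradU (hE : ContDiff ℝ 2 E) :
    Continuous fun z : Vec d × Vec d => gradU E z.1 z.2 := by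
  have h : Continuous (fderiv ℝ E) := hE.continuous_fderiv two_ne_zero
  have e : (fun z : Vec d × Vec d => gradU E z.1 z.2) = fun z =>
      (InnerProductSpace.toDual ℝ (Vec d)).symm
        ((fderiv ℝ E z).comp (ContinuousLinearMap.inl ℝ (Vec d) (Vec d))) := by
    funext z
    exact gradU_eq hE z.1 z.2
  rw [e]
  exact (InnerProductSpace.toDual ℝ (Vec d)).symm.continuous.comp (h.clm_comp continuous_const)

theorem apply_eq_apply_zero_of_gradV_eq_zero (hE : ContDiff ℝ 2 E) (h0 : ∀ p q, gradV E p q = 0)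
    (p q : Vec d) : E (p, q) = E (p, 0) := by
  have hd : Differentiable ℝ fun q' => E (p, q') :=
    (hE.differentiable two_ne_zero).comp (by fun_prop)
  refine is_const_of_fderiv_eq_zero hd (fun q' => ?_) q 0
  have := h0 p q'
  rw [gradV, gradient] at this
  simpa using this

theorem gradU_eq_gradU_zero (hE : ContDiff ℝ 2 E) (h0 : ∀ p q, gradV E p q = 0)
    (p q : Vec d) : gradU E p q = gradU E p 0 := by
  unfold gradU
  congr 1
  funext p'
  exact apply_eq_apply_zero_of_gradV_eq_zero hE h0 p' q

theorem hessV_eq (hE : ContDiff ℝ 2 E) (p q : Vec d) :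
    hessV E p q = (fderiv ℝ (fun z : Vec d × Vec d => gradV E z.1 z.2) (p, q)).comp
      (ContinuousLinearMap.inr ℝ (Vec d) (Vec d)) := by
  have h : HasFDerivAt (fun q' => gradV E p q')
      ((fderiv ℝ (fun z : Vec d × Vec d => gradV E z.1 z.2) (p, q)).comp
        (ContinuousLinearMap.inr ℝ (Vec d) (Vec d))) q :=
    ((contDiff_gradV hE).differentiable one_ne_zero (p, q)).hasFDerivAt.comp q
      (hasFDerivAt_prodMk_right p q)
  rw [hessV, h.fderiv]

theorem continuous_hessV (hE : ContDiff ℝ 2 E) :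
    Continuous fun z : Vec d × Vec d => hessV E z.1 z.2 := by
  have e : (fun z : Vec d × Vec d => hessV E z.1 z.2) = fun z =>
      (fderiv ℝ (fun z : Vec d × Vec d => gradV E z.1 z.2) z).comp
      (ContinuousLinearMap.inr ℝ (Vec d) (Vec d)) := by
    funext z
    exact hessV_eq hE z.1 z.2
  rw [e]
  exact ((contDiff_gradV hE).continuous_fderiv one_ne_zero).clm_comp continuous_const

theorem hasDerivAt_gradV_curve (hE : ContDiff ℝ 2 E) {u : ℝ → Vec d} (hu : ContDiff ℝ 2 u)
    (x : ℝ) : HasDerivAt (fun z => gradV E (u z) (deriv u z))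
      (fderiv ℝ (fun z : Vec d × Vec d => gradV E z.1 z.2) (u x, deriv u x) (deriv u x, 0)
        + hessV E (u x) (deriv u x) (deriv (deriv u) x)) x := by
  have h1 : HasDerivAt u (deriv u x) x := (hu.differentiable two_ne_zero x).hasDerivAt
  have h2 : HasDerivAt (deriv u) (deriv (deriv u) x) x :=
    (hu.differentiable_deriv_two x).hasDerivAt
  have h := ((contDiff_gradV hE).differentiable one_ne_zero
    (u x, deriv u x)).hasFDerivAt.comp_hasDerivAt x (h1.prodMk h2)
  refine h.congr_deriv ?_
  rw [hessV_eq hE, ContinuousLinearMap.comp_apply, ← map_add]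
  simp

/-- Along a curve, the derivative of `E - ⟪∇_v E, u'⟫` is the Euler–Lagrange expression of `E`
tested with `u'`. -/
theorem hasDerivAt_localEnergy (hE : ContDiff ℝ 2 E) {u : ℝ → Vec d}
    (hu : ContDiff ℝ 1 u) (h : (∀ p q, gradV E p q = 0) ∨ ContDiff ℝ 2 u) (x : ℝ) :
    HasDerivAt (fun x => E (u x, deriv u x) - inner ℝ (gradV E (u x) (deriv u x)) (deriv u x))
      (inner ℝ (-deriv (fun z => gradV E (u z) (deriv u z)) x + gradU E (u x) (deriv u x))
        (deriv u x)) x := by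
  have h1 : HasDerivAt u (deriv u x) x := (hu.differentiable one_ne_zero x).hasDerivAt
  rcases h with h0 | h
  -- Here `u` is only `C^1` and `u''` is unavailable; since `E` does not depend on `v`, the velocity
  -- can be replaced by `0`.
  · have e : (fun x => E (u x, deriv u x) - inner ℝ (gradV E (u x) (deriv u x)) (deriv u x))
        = fun x => E (u x, 0) := by
      funext x
      rw [h0, inner_zero_left, sub_zero, apply_eq_apply_zero_of_gradV_eq_zero hE h0]
    rw [e]
    have := (hE.differentiable two_ne_zero (u x, 0)).hasFDerivAt.comp_hasDerivAt x
      (h1.prodMk (hasDerivAt_const x (0 : Vec d)))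
    refine this.congr_deriv ?_
    simp only [h0, deriv_const, neg_zero, zero_add]
    rw [gradU_eq_gradU_zero hE h0, inner_gradU hE]
  · have h2 : HasDerivAt (deriv u) (deriv (deriv u) x) x :=
      (h.differentiable_deriv_two x).hasDerivAt
    have h3 := (hasDerivAt_gradV_curve hE h x).differentiableAt.hasDerivAt
    have h4 := (hE.differentiable two_ne_zero (u x, deriv u x)).hasFDerivAt.comp_hasDerivAt x
      (h1.prodMk h2)
    -- The two occurrences of `⟪∇_v E, u''⟫` cancel.
    refine (h4.sub (h3.inner ℝ h2)).congr_deriv ?_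
    have e : ((deriv u x, deriv (deriv u) x) : Vec d × Vec d)
        = (deriv u x, 0) + (0, deriv (deriv u) x) := by simp
    rw [e, map_add, ← inner_gradU hE, ← inner_gradV hE, inner_add_left, inner_neg_left]
    ring

end Lagrangian

/-! ### Bounds on the highest derivative from the equation. -/

section Regularity

theorem isUnit_of_forall_inner_pos {d : ℕ} {A : Vec d →L[ℝ] Vec d}
    (hA : ∀ w, w ≠ 0 → 0 < inner ℝ (A w) w) : IsUnit A := by
  have hinj : Function.Injective A.toLinearMap := by
    rw [← LinearMap.ker_eq_bot, LinearMap.ker_eq_bot']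
    intro w hw
    by_contra h
    have := hA w h
    rw [show A w = 0 from hw, inner_zero_left] at this
    exact lt_irrefl _ this
  rw [ContinuousLinearMap.isUnit_iff_bijective]
  exact ⟨hinj, LinearMap.injective_iff_surjective.mp hinj⟩

/-- `Ring.inverse` is total but continuous only at units; all values of `A` are units, so its junk
value never occurs. -/
theorem continuous_ringInverse_comp {d : ℕ} {X : Type*} [TopologicalSpace X]
    {A : X → Vec d →L[ℝ] Vec d} (hA : Continuous A) (hu : ∀ x, IsUnit (A x)) :
    Continuous fun x => Ring.inverse (A x) := by
  rw [continuous_iff_continuousAt]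
  intro x
  have h := NormedRing.inverse_continuousAt (hu x).unit
  rw [(hu x).unit_spec] at h
  exact h.comp hA.continuousAt

theorem ringInverse_apply_apply {d : ℕ} {A : Vec d →L[ℝ] Vec d} (hA : IsUnit A) (w : Vec d) :
    Ring.inverse A (A w) = w :=
  DFunLike.congr_fun (Ring.inverse_mul_cancel A hA) w

variable {d : ℕ} {E : Vec d × Vec d → ℝ} {S : Vec d → Vec d} {K : ℝ → Vec d →L[ℝ] Vec d}
  {Γ : Vec d → Vec d →L[ℝ] Vec d} {c : ℝ} {u : ℝ → Vec d}

theorem deriv_comp_curve (hS : ContDiff ℝ 2 S) (hu : ContDiff ℝ 1 u) (x : ℝ) :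
    deriv (fun y => S (u y)) x = fderiv ℝ S (u x) (deriv u x) :=
  ((hS.differentiable two_ne_zero (u x)).hasFDerivAt.comp_hasDerivAt x
    (hu.differentiable one_ne_zero x).hasDerivAt).deriv

theorem exists_norm_deriv_comp_le (hS : ContDiff ℝ 2 S) (hu : ContDiff ℝ 1 u) {M M' : ℝ}
    (hM : ∀ x, ‖u x‖ ≤ M) (hM' : ∀ x, ‖deriv u x‖ ≤ M') :
    ∃ C, ∀ x, ‖deriv (fun y => S (u y)) x‖ ≤ C := by
  have hF : Continuous fun z : Vec d × Vec d => fderiv ℝ S z.1 z.2 :=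
    ((hS.continuous_fderiv two_ne_zero).comp continuous_fst).clm_apply continuous_snd
  obtain ⟨C, hC⟩ := exists_norm_comp_le (w := fun x => (u x, deriv u x)) (M := max M M') hF
    fun x => max_le_max (hM x) (hM' x)
  refine ⟨C, fun x => ?_⟩
  rw [deriv_comp_curve hS hu]
  exact hC x

theorem uniformContinuous_conv_comp (hS : ContDiff ℝ 2 S) (hK : Integrable K)
    (hu : ContDiff ℝ 1 u) {M M' : ℝ} (hM : ∀ x, ‖u x‖ ≤ M) (hM' : ∀ x, ‖deriv u x‖ ≤ M') :
    UniformContinuous (conv K fun y => S (u y)) := by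
  obtain ⟨C, hC⟩ := exists_norm_comp_le hS.continuous hM
  obtain ⟨C', hC'⟩ := exists_norm_deriv_comp_le hS hu hM hM'
  exact uniformContinuous_conv
    ((hS.differentiable two_ne_zero).comp (hu.differentiable one_ne_zero)) hC hC' hK

theorem continuous_adjoint_fderiv (hS : ContDiff ℝ 2 S) :
    Continuous fun p => ContinuousLinearMap.adjoint (fderiv ℝ S p) :=
  (ContinuousLinearMap.adjoint (𝕜 := ℝ) (E := Vec d) (F := Vec d)).continuous.comp
    (hS.continuous_fderiv two_ne_zero)

/-- A bounded solution of the first order equation has a bounded and uniformly continuous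
derivative. -/
theorem deriv_bounded_of_gradV_eq_zero (hE : ContDiff ℝ 2 E) (hS : ContDiff ℝ 2 S)
    (hK : Integrable K) (hΓ : HypothesisGamma Γ) (hc : c ≠ 0) (h0 : ∀ p q, gradV E p q = 0)
    (hu : ContDiff ℝ 1 u) (hsol : IsSolution E S K Γ c u) {M : ℝ} (hM : ∀ x, ‖u x‖ ≤ M) :
    (∃ C, ∀ x, ‖deriv u x‖ ≤ C) ∧ UniformContinuous (deriv u) := by
  -- The equation solved for `u'` in terms of `(u, K * S(u))`.
  set F : Vec d × Vec d → Vec d := fun z => Ring.inverse (Γ z.1)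
    (c⁻¹ • (gradU E z.1 0 + ContinuousLinearMap.adjoint (fderiv ℝ S z.1) z.2)) with hFdef
  have hΓu : ∀ p, IsUnit (Γ p) := fun p => isUnit_of_forall_inner_pos (hΓ.posDef p)
  have hF : Continuous F := by
    have h1 : Continuous fun z : Vec d × Vec d => gradU E z.1 0 :=
      (continuous_gradU hE).comp (continuous_fst.prodMk continuous_const)
    have h2 : Continuous fun z : Vec d × Vec d =>
        ContinuousLinearMap.adjoint (fderiv ℝ S z.1) z.2 :=
      ((continuous_adjoint_fderiv hS).comp continuous_fst).clm_apply continuous_snd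
    exact Continuous.clm_apply
      (continuous_ringInverse_comp (hΓ.continuous.comp continuous_fst) fun z => hΓu _)
      ((h1.add h2).const_smul c⁻¹)
  have hw : ∀ x, deriv u x = F (u x, conv K (fun y => S (u y)) x) := by
    intro x
    have h := hsol x
    simp only [h0, deriv_const, neg_zero, zero_add] at h
    rw [gradU_eq_gradU_zero hE h0] at h
    simp only [hFdef, h]
    rw [inv_smul_smul₀ hc, ringInverse_apply_apply (hΓu _)]
  obtain ⟨C₁, hC₁⟩ := exists_norm_comp_le hS.continuous hM
  have hb : ∀ x, ‖(u x, conv K (fun y => S (u y)) x)‖ ≤ max M (∫ r, ‖K r‖ * C₁) := fun x =>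
    max_le_max (hM x) (norm_conv_le hC₁ hK x)
  obtain ⟨C, hC⟩ := exists_norm_comp_le hF hb
  have hC' : ∀ x, ‖deriv u x‖ ≤ C := fun x => by rw [hw]; exact hC x
  refine ⟨⟨C, hC'⟩, ?_⟩
  -- Bootstrap: the bound on `u'` makes `u` and `K * S(u)` uniformly continuous, and then `u'` as
  -- well.
  have huc := uniformContinuous_of_norm_deriv_le (hu.differentiable one_ne_zero) hC'
  have := uniformContinuous_comp_of_bounded hF hb
    (huc.prodMk (uniformContinuous_conv_comp hS hK hu hM hC'))
  exact (funext hw : deriv u = _) ▸ this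

/-- A solution of the second order equation which is bounded together with its first derivative has
a bounded and uniformly continuous second derivative. -/
theorem deriv_deriv_bounded_of_isUnit_hessV (hE : ContDiff ℝ 2 E) (hS : ContDiff ℝ 2 S)
    (hK : Integrable K) (hΓ : HypothesisGamma Γ) (h0 : ∀ p q, IsUnit (hessV E p q))
    (hu : ContDiff ℝ 2 u) (hsol : IsSolution E S K Γ c u) {M M' : ℝ} (hM : ∀ x, ‖u x‖ ≤ M)
    (hM' : ∀ x, ‖deriv u x‖ ≤ M') :
    (∃ C, ∀ x, ‖deriv (deriv u) x‖ ≤ C) ∧ UniformContinuous (deriv (deriv u)) := by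
  have hu1 : ContDiff ℝ 1 u := hu.of_le one_le_two
  set G : Vec d × Vec d → Vec d := fun z => gradV E z.1 z.2 with hG
  -- The equation solved for `u''`, after expanding `∂_x ∇_v E(u,u')` by the chain rule.
  set F : (Vec d × Vec d) × Vec d → Vec d := fun z => Ring.inverse (hessV E z.1.1 z.1.2)
    (gradU E z.1.1 z.1.2 + ContinuousLinearMap.adjoint (fderiv ℝ S z.1.1) z.2
      - c • Γ z.1.1 z.1.2 - fderiv ℝ G z.1 (z.1.2, 0)) with hFdef
  have hF : Continuous F := by
    have f1 : Continuous fun z : (Vec d × Vec d) × Vec d => z.1.1 :=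
      continuous_fst.comp continuous_fst
    have f2 : Continuous fun z : (Vec d × Vec d) × Vec d => z.1.2 :=
      continuous_snd.comp continuous_fst
    refine Continuous.clm_apply
      (continuous_ringInverse_comp ((continuous_hessV hE).comp continuous_fst) fun z => h0 _ _)
      (((Continuous.add ?_ ?_).sub ?_).sub ?_)
    · exact (continuous_gradU hE).comp continuous_fst
    · exact ((continuous_adjoint_fderiv hS).comp f1).clm_apply continuous_snd
    · exact ((hΓ.continuous.comp f1).clm_apply f2).const_smul c
    · exact (((contDiff_gradV hE).continuous_fderiv one_ne_zero).comp continuous_fst).clm_apply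
        (f2.prodMk continuous_const)
  have hw : ∀ x, deriv (deriv u) x = F ((u x, deriv u x), conv K (fun y => S (u y)) x) := by
    intro x
    have h := hsol x
    rw [(hasDerivAt_gradV_curve hE hu x).deriv] at h
    have h' : gradU E (u x) (deriv u x)
        + ContinuousLinearMap.adjoint (fderiv ℝ S (u x)) (conv K (fun y => S (u y)) x)
        - c • Γ (u x) (deriv u x) - fderiv ℝ G (u x, deriv u x) (deriv u x, 0)
        = hessV E (u x) (deriv u x) (deriv (deriv u) x) := by
      rw [← h]
      abel
    simp only [hFdef, h']
    rw [ringInverse_apply_apply (h0 _ _)]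
  obtain ⟨C₁, hC₁⟩ := exists_norm_comp_le hS.continuous hM
  have hb : ∀ x, ‖((u x, deriv u x), conv K (fun y => S (u y)) x)‖
      ≤ max (max M M') (∫ r, ‖K r‖ * C₁) := fun x =>
    max_le_max (max_le_max (hM x) (hM' x)) (norm_conv_le hC₁ hK x)
  obtain ⟨C, hC⟩ := exists_norm_comp_le hF hb
  have hC' : ∀ x, ‖deriv (deriv u) x‖ ≤ C := fun x => by rw [hw]; exact hC x
  refine ⟨⟨C, hC'⟩, ?_⟩
  have huc := uniformContinuous_of_norm_deriv_le (hu.differentiable two_ne_zero) hM'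
  have huc' := uniformContinuous_of_norm_deriv_le hu.differentiable_deriv_two hC'
  have := uniformContinuous_comp_of_bounded hF hb
    ((huc.prodMk huc').prodMk (uniformContinuous_conv_comp hS hK hu1 hM hM'))
  exact (funext hw : deriv (deriv u) = _) ▸ this

end Regularity

/-! ### Compactness of translates in `C^k_loc`. -/

section Compactness

/-- Ascoli by ultrafilters: compact balls give pointwise limits, and the common modulus of
continuity of the translates makes the convergence locally uniform. -/
theorem exists_tendstoLocallyUniformly_translates {G : Type*} [SeminormedAddCommGroup G]
    [ProperSpace G] {w : ℝ → G} {C : ℝ} (hC : ∀ x, ‖w x‖ ≤ C) (hw : UniformContinuous w)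
    (𝒰 : Ultrafilter ℝ) :
    ∃ g : ℝ → G, TendstoLocallyUniformly (fun τ x => w (x + τ)) g 𝒰 := by
  have hlim : ∀ x, ∃ y, Tendsto (fun τ => w (x + τ)) 𝒰 (𝓝 y) := fun x => by
    obtain ⟨y, -, hy⟩ := (isCompact_closedBall (0 : G) C).ultrafilter_le_nhds'
      (𝒰.map fun τ => w (x + τ))
      (Filter.mem_map.mpr (Filter.univ_mem' fun τ => by simpa using hC (x + τ)))
    exact ⟨y, hy⟩
  choose g hg using hlim
  refine ⟨g, Metric.tendstoLocallyUniformly_iff.mpr fun ε hε x => ?_⟩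
  obtain ⟨δ, hδ, hwδ⟩ := Metric.uniformContinuous_iff.mp hw (ε / 4) (by positivity)
  refine ⟨Metric.ball x δ, Metric.ball_mem_nhds x hδ, ?_⟩
  filter_upwards [Metric.tendsto_nhds.mp (hg x) (ε / 4) (by positivity)] with τ hτ y hy
  have h1 : ∀ σ, dist (w (y + σ)) (w (x + σ)) < ε / 4 := fun σ => hwδ (by simpa using hy)
  have h2 : dist (g y) (g x) ≤ ε / 4 :=
    le_of_tendsto ((hg y).dist (hg x)) (Eventually.of_forall fun σ => (h1 σ).le)
  have h3 := dist_triangle4_right (g y) (w (y + τ)) (g x) (w (x + τ))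
  have h4 := h1 τ
  rw [dist_comm (w (x + τ)) (g x)] at hτ
  linarith

namespace CkLoc

variable {d k : ℕ}

theorem tendsto_iff_jet {ι : Type*} {l : Filter ι} {F : ι → CkLoc d k} {v : CkLoc d k} :
    Tendsto F l (𝓝 v) ↔ ∀ j, Tendsto (fun i => jet (F i) j) l (𝓝 (jet v j)) := by
  rw [nhds_induced, tendsto_comap_iff, tendsto_pi_nhds]
  rfl

/-- Keeps the filters converging to a limit point countably generated, as dominated convergence
requires. -/
instance : FirstCountableTopology (CkLoc d k) :=
  Topology.IsInducing.firstCountableTopology (f := jet) ⟨rfl⟩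

theorem jet_shift (u : CkLoc d k) (τ : ℝ) (j : Fin (k + 1)) (x : ℝ) :
    jet (shift τ u) j x = iteratedDeriv j u (x + τ) :=
  congrFun (iteratedDeriv_comp_add_const j u.1 τ) x

/-- If all derivatives of order at most `k` are bounded and uniformly continuous, then the
translates have cluster points in `C^k_loc`. -/
theorem exists_mapClusterPt_shift (u : CkLoc d k) (hb : BoundedUpTo k u)
    (huc : ∀ j ≤ k, UniformContinuous (iteratedDeriv j u)) (l : Filter ℝ) [l.NeBot] :
    ∃ v : CkLoc d k, MapClusterPt v l fun τ => shift τ u := by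
  -- One ultrafilter serves all orders, so the limits of successive derivatives are compatible.
  set 𝒰 := Ultrafilter.of l
  have hex : ∀ j, ∃ g : ℝ → Vec d, j ≤ k →
      TendstoLocallyUniformly (fun τ x => iteratedDeriv j u (x + τ)) g 𝒰 := fun j => by
    by_cases hj : j ≤ k
    · obtain ⟨C, hC⟩ := hb j hj
      obtain ⟨g, hg⟩ := exists_tendstoLocallyUniformly_translates hC (huc j hj) 𝒰
      exact ⟨g, fun _ => hg⟩
    · exact ⟨0, fun h => absurd h hj⟩
  choose g hg using hex
  have hcont : ∀ j ≤ k, Continuous (g j) := fun j hj =>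
    (hg j hj).continuous (Eventually.of_forall fun τ =>
      ((u.2.continuous_iteratedDeriv j (by exact_mod_cast hj)).comp (by fun_prop))).frequently
  have hder : ∀ j, j < k → ∀ x, HasDerivAt (g j) (g (j + 1) x) x := fun j hj x => by
    refine hasDerivAt_of_tendstoLocallyUniformlyOn isOpen_univ
      (tendstoLocallyUniformlyOn_univ.mpr (hg (j + 1) hj))
      (Eventually.of_forall fun τ y _ => ?_)
      (fun y _ => ((tendstoLocallyUniformlyOn_univ.mpr (hg j hj.le)).tendsto_at (Set.mem_univ y)))
      (Set.mem_univ x)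
    have h := (u.2.differentiable_iteratedDeriv j (by exact_mod_cast hj) (y + τ)).hasDerivAt
    rw [← iteratedDeriv_succ] at h
    exact h.comp_add_const y τ
  have hiter : ∀ j ≤ k, iteratedDeriv j (g 0) = g j := fun j => by
    induction j with
    | zero => exact fun _ => iteratedDeriv_zero
    | succ j ih =>
      intro hj
      rw [iteratedDeriv_succ, ih (Nat.le_of_succ_le hj)]
      exact funext fun x => (hder j hj x).deriv
  have hC : ContDiff ℝ (k : WithTop ℕ∞) (g 0) := by
    refine contDiff_nat_iff_iteratedDeriv.mpr ⟨fun j hj => ?_, fun j hj => ?_⟩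
    · rw [hiter j hj]
      exact hcont j hj
    · rw [hiter j hj.le]
      exact fun x => (hder j hj x).differentiableAt
  refine ⟨⟨g 0, hC⟩, mapClusterPt_iff_ultrafilter.mpr ⟨𝒰, Ultrafilter.of_le l, ?_⟩⟩
  refine tendsto_iff_jet.mpr fun j => ?_
  have hj : (j : ℕ) ≤ k := Nat.lt_succ_iff.mp j.2
  rw [ContinuousMap.tendsto_iff_tendstoLocallyUniformly]
  refine (hg j hj).congr_right (fun x => ?_) |>.congr fun τ x => ?_
  · exact (congrFun (hiter j hj) x).symm
  · exact (jet_shift u τ j x).symm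

/-- A cluster point of the translates is a pointwise limit, with its derivatives, along a countably
generated filter. -/
theorem exists_filter_of_mapClusterPt {u v : CkLoc d k} {l : Filter ℝ} [l.IsCountablyGenerated]
    (h : MapClusterPt v l fun τ => shift τ u) :
    ∃ l' : Filter ℝ, l' ≤ l ∧ l'.NeBot ∧ l'.IsCountablyGenerated ∧
      ∀ j ≤ k, ∀ x, Tendsto (fun τ => iteratedDeriv j u (x + τ)) l' (𝓝 (iteratedDeriv j v x)) := by
  refine ⟨l ⊓ comap (fun τ => shift τ u) (𝓝 v), inf_le_left, ?_, inferInstance, fun j hj x => ?_⟩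
  · rw [← map_neBot_iff (fun τ => shift τ u), Filter.push_pull, inf_comm]
    exact h
  · have h1 : Tendsto (fun τ => shift τ u) (l ⊓ comap (fun τ => shift τ u) (𝓝 v)) (𝓝 v) :=
      tendsto_comap.mono_left inf_le_right
    have h2 := tendsto_iff_jet.mp h1 ⟨j, Nat.lt_succ_of_le hj⟩
    have h3 := ((continuous_eval_const x).tendsto _).comp h2
    exact h3.congr fun τ => jet_shift u τ _ x

end CkLoc

end Compactness

/-! ### Abstract Lyapunov arguments. -/

section Lyapunov

/-- A bounded function whose derivative has constant sign has limits at `±∞`, and is constant if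
these coincide. -/
theorem exists_limits_of_bounded_of_deriv_sign {H q : ℝ → ℝ} {c C : ℝ} (hc : c ≠ 0)
    (hH : ∀ x, HasDerivAt H (c * q x) x) (hq : ∀ x, 0 ≤ q x) (hC : ∀ x, |H x| ≤ C) :
    ∃ a b, Tendsto H atBot (𝓝 a) ∧ Tendsto H atTop (𝓝 b) ∧ (a = b → ∀ x, q x = 0) := by
  -- Multiplying by `c` gives the derivative `c² q ≥ 0` whatever the sign of `c`.
  have hd : ∀ x, HasDerivAt (fun x => c * H x) (c * (c * q x)) x := fun x => (hH x).const_mul c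
  have hmono : Monotone fun x => c * H x := monotone_of_hasDerivAt_nonneg hd fun x => by
    rw [← mul_assoc]
    exact mul_nonneg (mul_self_nonneg c) (hq x)
  have hbd : ∀ x, |c * H x| ≤ |c| * C := fun x => by
    rw [abs_mul]
    exact mul_le_mul_of_nonneg_left (hC x) (abs_nonneg c)
  have hba : BddAbove (Set.range fun x => c * H x) :=
    ⟨|c| * C, Set.forall_mem_range.mpr fun x => (abs_le.mp (hbd x)).2⟩
  have hbb : BddBelow (Set.range fun x => c * H x) :=
    ⟨-(|c| * C), Set.forall_mem_range.mpr fun x => (abs_le.mp (hbd x)).1⟩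
  have ht := tendsto_atTop_ciSup hmono hba
  have hb := tendsto_atBot_ciInf hmono hbb
  have hdiv : ∀ {l : Filter ℝ} {a : ℝ}, Tendsto (fun x => c * H x) l (𝓝 a) →
      Tendsto H l (𝓝 (c⁻¹ * a)) := fun h =>
    (h.const_mul c⁻¹).congr fun x => inv_mul_cancel_left₀ hc _
  refine ⟨_, _, hdiv hb, hdiv ht, fun hab x => ?_⟩
  have hab' := mul_left_cancel₀ (inv_ne_zero hc) hab
  have hconst : (fun x => c * H x) = fun _ => ⨅ x, c * H x := funext fun x =>
    le_antisymm ((le_ciSup hba x).trans hab'.ge) (ciInf_le hbb x)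
  have h0 := (hd x).unique (hconst ▸ hasDerivAt_const x _)
  simpa [hc] using h0

/-- If `H' = c q(u, u')` with `q` nonnegative and `H` converges along a translation invariant
filter, then `q` vanishes along every limit of translates of `u`. -/
theorem eq_zero_of_tendsto_translates {X : Type*} [TopologicalSpace X] {Q : X → ℝ} {H : ℝ → ℝ}
    {w z : ℝ → X} {c a C : ℝ} (hc : c ≠ 0) (hQ : Continuous Q) (hQ0 : ∀ p, 0 ≤ Q p)
    (hw : Continuous w) (hz : Continuous z) (hH : ∀ x, HasDerivAt H (c * Q (w x)) x)
    (hC : ∀ x, |Q (w x)| ≤ C) {l l' : Filter ℝ} (hl : ∀ x, Tendsto (fun τ => x + τ) l l)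
    (hla : Tendsto H l (𝓝 a)) (hl' : l' ≤ l) [l'.NeBot] [l'.IsCountablyGenerated]
    (hwz : ∀ x, Tendsto (fun τ => w (x + τ)) l' (𝓝 (z x))) (x : ℝ) : Q (z x) = 0 := by
  -- Both ends of the moving unit window have the same limit `a`.
  have h1 : Tendsto (fun τ => H (x + 1 + τ) - H (x + τ)) l' (𝓝 0) := by
    simpa using ((hla.comp (hl (x + 1))).sub (hla.comp (hl x))).mono_left hl'
  have h2 : Tendsto (fun τ => ∫ s in x..(x + 1), Q (w (s + τ))) l'
      (𝓝 (∫ s in x..(x + 1), Q (z s))) :=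
    intervalIntegral.tendsto_integral_filter_of_dominated_convergence (fun _ => C)
      (Eventually.of_forall fun τ => Continuous.aestronglyMeasurable (by fun_prop))
      (Eventually.of_forall fun τ => ae_of_all _ fun s _ => hC _) intervalIntegrable_const
      (ae_of_all _ fun s _ => (hQ.tendsto _).comp (hwz s))
  have h3 : ∀ τ, ∫ s in x..(x + 1), Q (w (s + τ)) = c⁻¹ * (H (x + 1 + τ) - H (x + τ)) := by
    intro τ
    have hi : IntervalIntegrable (fun s => c * Q (w s)) volume (x + τ) (x + 1 + τ) :=
      Continuous.intervalIntegrable (by fun_prop) _ _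
    rw [intervalIntegral.integral_comp_add_right (fun s => Q (w s)),
      ← intervalIntegral.integral_eq_sub_of_hasDerivAt (fun s _ => hH s) hi,
      intervalIntegral.integral_const_mul, inv_mul_cancel_left₀ hc]
  have h4 : ∫ s in x..(x + 1), Q (z s) = 0 := by
    simp_rw [h3] at h2
    simpa using tendsto_nhds_unique h2 (h1.const_mul c⁻¹)
  -- A nonnegative continuous function, positive at the left endpoint, would have positive integral.
  by_contra hne
  have := intervalIntegral.integral_pos (lt_add_one x) (hQ.comp hz).continuousOn
    (fun s _ => hQ0 (z s)) ⟨x, ⟨le_rfl, (lt_add_one x).le⟩, (hQ0 (z x)).lt_of_ne' hne⟩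
  exact this.ne' h4

end Lyapunov

/-! ### The Lyapunov function on solutions. -/

section Solutions

variable {d : ℕ} {E : Vec d × Vec d → ℝ} {S : Vec d → Vec d} {K : ℝ → Vec d →L[ℝ] Vec d}
  {Γ : Vec d → Vec d →L[ℝ] Vec d} {c : ℝ} {u : ℝ → Vec d}

/-- The Lyapunov function of the shift on solutions. -/
noncomputable def lyapunov (E : Vec d × Vec d → ℝ) (S : Vec d → Vec d)
    (K : ℝ → Vec d →L[ℝ] Vec d) (u : ℝ → Vec d) (x : ℝ) : ℝ :=
  E (u x, deriv u x) - inner ℝ (gradV E (u x) (deriv u x)) (deriv u x)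
    + nonlocalEnergy K (fun y => S (u y)) x

/-- Moving `DS(u)ᵀ` to the other side of the inner product turns `u'` into the derivative of `S ∘
u`, so local and nonlocal energies add up to the equation tested with `u'`. -/
theorem hasDerivAt_lyapunov (hE : ContDiff ℝ 2 E) (hS : ContDiff ℝ 2 S) (hK : HypothesisK K)
    (hu : ContDiff ℝ 1 u) (h : (∀ p q, gradV E p q = 0) ∨ ContDiff ℝ 2 u)
    (hsol : IsSolution E S K Γ c u) {M M' : ℝ} (hM : ∀ x, ‖u x‖ ≤ M)
    (hM' : ∀ x, ‖deriv u x‖ ≤ M') (x : ℝ) :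
    HasDerivAt (lyapunov E S K u) (c * inner ℝ (Γ (u x) (deriv u x)) (deriv u x)) x := by
  obtain ⟨C, hC⟩ := exists_norm_comp_le hS.continuous hM
  obtain ⟨C', hC'⟩ := exists_norm_deriv_comp_le hS hu hM hM'
  have hSu : ContDiff ℝ 1 fun y => S (u y) := (hS.of_le one_le_two).comp hu
  refine ((hasDerivAt_localEnergy hE hu h x).add
    (hasDerivAt_nonlocalEnergy hSu hC hC' hK x)).congr_deriv ?_
  rw [← real_inner_smul_left, ← hsol x, deriv_comp_curve hS hu, inner_add_left _
    (ContinuousLinearMap.adjoint (fderiv ℝ S (u x)) (conv K (fun y => S (u y)) x)),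
    ContinuousLinearMap.adjoint_inner_left]

theorem continuous_localEnergy (hE : ContDiff ℝ 2 E) :
    Continuous fun z : Vec d × Vec d => E z - inner ℝ (gradV E z.1 z.2) z.2 :=
  hE.continuous.sub ((contDiff_gradV hE).continuous.inner continuous_snd)

theorem exists_abs_lyapunov_le (hE : ContDiff ℝ 2 E) (hS : ContDiff ℝ 2 S) (hK : HypothesisK K)
    (hu : ContDiff ℝ 1 u) {M M' : ℝ} (hM : ∀ x, ‖u x‖ ≤ M) (hM' : ∀ x, ‖deriv u x‖ ≤ M') :
    ∃ C, ∀ x, |lyapunov E S K u x| ≤ C := by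
  obtain ⟨C, hC⟩ := exists_norm_comp_le hS.continuous hM
  obtain ⟨C', hC'⟩ := exists_norm_deriv_comp_le hS hu hM hM'
  obtain ⟨B, hB⟩ := exists_norm_comp_le (w := fun x => (u x, deriv u x)) (M := max M M')
    (continuous_localEnergy hE) fun x => max_le_max (hM x) (hM' x)
  exact ⟨_, fun x => (abs_add_le _ _).trans (add_le_add (hB x) (abs_nonlocalEnergy_le hC hC' hK x))⟩

/-- The limit value depends on `p` alone, not on the end at which it is approached; disjointness of
the limit sets rests on this. -/
theorem tendsto_lyapunov (hE : ContDiff ℝ 2 E) (hS : ContDiff ℝ 2 S) (hK : HypothesisK K)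
    (hu : ContDiff ℝ 1 u) {M M' : ℝ} (hM : ∀ x, ‖u x‖ ≤ M) (hM' : ∀ x, ‖deriv u x‖ ≤ M')
    {l : Filter ℝ} [l.IsCountablyGenerated] {p : Vec d}
    (h : ∀ x, Tendsto (fun τ => u (x + τ)) l (𝓝 p))
    (h' : ∀ x, Tendsto (fun τ => deriv u (x + τ)) l (𝓝 0)) :
    Tendsto (lyapunov E S K u) l (𝓝 (E (p, 0) + 1 / 2 * ∫ r, inner ℝ (K r (S p)) (S p))) := by
  obtain ⟨C, hC⟩ := exists_norm_comp_le hS.continuous hM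
  obtain ⟨C', hC'⟩ := exists_norm_deriv_comp_le hS hu hM hM'
  have hSu : ContDiff ℝ 1 fun y => S (u y) := (hS.of_le one_le_two).comp hu
  refine Tendsto.add ?_ (tendsto_nonlocalEnergy hSu hC hC' hK
    (fun x => (hS.continuous.tendsto p).comp (h x)) fun x => ?_)
  · have hp : Tendsto (fun τ => (u τ, deriv u τ)) l (𝓝 (p, 0)) := by
      simpa using (h 0).prodMk_nhds (h' 0)
    simpa [Function.comp_def] using ((continuous_localEnergy hE).tendsto (p, 0)).comp hp
  · simp_rw [deriv_comp_curve hS hu]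
    have hF : Continuous fun z : Vec d × Vec d => fderiv ℝ S z.1 z.2 :=
      ((hS.continuous_fderiv two_ne_zero).comp continuous_fst).clm_apply continuous_snd
    simpa [Function.comp_def] using (hF.tendsto (p, 0)).comp ((h x).prodMk_nhds (h' x))

/-- Boundedness is assumed only up to order `R - 1`; the equation supplies order `R`. -/
theorem bounded_uniformContinuous_iteratedDeriv (hG : HypothesisG E S) (hE : ContDiff ℝ 2 E)
    (hS : ContDiff ℝ 2 S) (hK : Integrable K) (hΓ : HypothesisGamma Γ) (hc : c ≠ 0)
    (u : CkLoc d (regularity E)) (hsol : IsSolution E S K Γ c u)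
    (hb : CkLoc.BoundedUpTo (regularity E - 1) u) :
    CkLoc.BoundedUpTo (regularity E) u ∧
      ∀ j ≤ regularity E, UniformContinuous (iteratedDeriv j u) := by
  obtain ⟨M, hM⟩ := hb 0 (Nat.zero_le _)
  simp only [iteratedDeriv_zero] at hM
  by_cases h0 : ∀ p q, gradV E p q = 0
  · have hR : regularity E = 1 := if_pos h0
    have hu : ContDiff ℝ 1 u.1 := u.2.of_le (by rw [hR]; norm_num)
    obtain ⟨⟨C, hC⟩, huc⟩ := deriv_bounded_of_gradV_eq_zero hE hS hK hΓ hc h0 hu hsol hM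
    have huc0 := uniformContinuous_of_norm_deriv_le (hu.differentiable one_ne_zero) hC
    have key : ∀ j ≤ 1, (∃ C, ∀ x, ‖iteratedDeriv j u.1 x‖ ≤ C) ∧
        UniformContinuous (iteratedDeriv j u.1) := fun j hj => by
      interval_cases j
      · simpa only [iteratedDeriv_zero] using And.intro ⟨M, hM⟩ huc0
      · simpa only [iteratedDeriv_one] using And.intro ⟨C, hC⟩ huc
    exact ⟨fun j hj => (key j (hj.trans hR.le)).1, fun j hj => (key j (hj.trans hR.le)).2⟩
  · have hR : regularity E = 2 := if_neg h0
    have hu : ContDiff ℝ 2 u.1 := u.2.of_le (by rw [hR]; norm_num)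
    obtain ⟨M', hM'⟩ := hb 1 (by rw [hR])
    simp only [iteratedDeriv_one] at hM'
    obtain ⟨⟨C, hC⟩, huc⟩ := deriv_deriv_bounded_of_isUnit_hessV hE hS hK hΓ
      (hG.nondegenerate.resolve_left h0) hu hsol hM hM'
    have huc0 := uniformContinuous_of_norm_deriv_le (hu.differentiable two_ne_zero) hM'
    have huc1 := uniformContinuous_of_norm_deriv_le hu.differentiable_deriv_two hC
    have e2 : iteratedDeriv 2 u.1 = deriv (deriv u.1) := by
      rw [iteratedDeriv_succ, iteratedDeriv_one]
    have key : ∀ j ≤ 2, (∃ C, ∀ x, ‖iteratedDeriv j u.1 x‖ ≤ C) ∧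
        UniformContinuous (iteratedDeriv j u.1) := fun j hj => by
      interval_cases j
      · simpa only [iteratedDeriv_zero] using And.intro ⟨M, hM⟩ huc0
      · simpa only [iteratedDeriv_one] using And.intro ⟨M', hM'⟩ huc1
      · simpa only [e2] using And.intro ⟨C, hC⟩ huc
    exact ⟨fun j hj => (key j (hj.trans hR.le)).1, fun j hj => (key j (hj.trans hR.le)).2⟩

theorem one_le_regularity (E : Vec d × Vec d → ℝ) : 1 ≤ regularity E := by
  unfold regularity
  split <;> norm_num

theorem CkLoc.isConst_of_deriv_eq_zero {k : ℕ} (hk : 1 ≤ k) {v : CkLoc d k}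
    (h : ∀ x, deriv v x = 0) : v.IsConst :=
  ⟨v 0, fun x => is_const_of_deriv_eq_zero
    (v.2.differentiable (by exact_mod_cast Nat.one_le_iff_ne_zero.mp hk)) h x 0⟩

end Solutions

end GradLike

theorem theorem4 {d : ℕ}
    (E : GradLike.Vec d × GradLike.Vec d → ℝ) (S : GradLike.Vec d → GradLike.Vec d)
    (K : ℝ → GradLike.Vec d →L[ℝ] GradLike.Vec d)
    (Γ : GradLike.Vec d → GradLike.Vec d →L[ℝ] GradLike.Vec d) (c : ℝ)
    (hK : GradLike.HypothesisK K) (hG : GradLike.HypothesisG E S)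
    (hΓ : GradLike.HypothesisGamma Γ) (hc : c ≠ 0)
    (u : GradLike.CkLoc d (GradLike.regularity E))
    (hu : GradLike.IsSolution E S K Γ c u)
    (hbdd : GradLike.CkLoc.BoundedUpTo (GradLike.regularity E - 1) u) :
    (GradLike.CkLoc.alphaLimit {u}).Nonempty ∧
    (GradLike.CkLoc.omegaLimitSet {u}).Nonempty ∧
    (∀ v ∈ GradLike.CkLoc.alphaLimit {u}, v.IsConst) ∧
    (∀ v ∈ GradLike.CkLoc.omegaLimitSet {u}, v.IsConst) ∧
    (¬ u.IsConst →
      GradLike.CkLoc.alphaLimit {u} ∩ GradLike.CkLoc.omegaLimitSet {u} = ∅) := by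
  open GradLike CkLoc in
  have hR := one_le_regularity E
  have hR2 : (2 : WithTop ℕ∞) ≤ ((regularity E + 1 : ℕ) : WithTop ℕ∞) := by
    exact_mod_cast Nat.succ_le_succ hR
  have hE : ContDiff ℝ 2 E := hG.smooth_E.of_le hR2
  have hS : ContDiff ℝ 2 S := hG.smooth_S.of_le hR2
  have hu1 : ContDiff ℝ 1 u.1 := u.2.of_le (by exact_mod_cast hR)
  obtain ⟨hb, huc⟩ :=
    bounded_uniformContinuous_iteratedDeriv hG hE hS hK.integrable hΓ hc u hu hbdd
  obtain ⟨M, hM⟩ := hb 0 (Nat.zero_le _)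
  obtain ⟨M', hM'⟩ := hb 1 hR
  simp only [iteratedDeriv_zero, iteratedDeriv_one] at hM hM'
  have hcase : (∀ p q, gradV E p q = 0) ∨ ContDiff ℝ 2 u.1 := by
    by_cases h0 : ∀ p q, gradV E p q = 0
    · exact Or.inl h0
    · exact Or.inr (u.2.of_le (by rw [regularity, if_neg h0]; norm_num))
  let Q : Vec d × Vec d → ℝ := fun z => inner ℝ (Γ z.1 z.2) z.2
  have hQ : Continuous Q :=
    ((hΓ.continuous.comp continuous_fst).clm_apply continuous_snd).inner continuous_snd
  have hQ0 : ∀ z, 0 ≤ Q z := fun z => by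
    by_cases hz : z.2 = 0
    · simp [Q, hz]
    · exact (hΓ.posDef z.1 z.2 hz).le
  have hQ1 : ∀ z, Q z = 0 → z.2 = 0 := fun z hz => by
    by_contra h
    exact (hΓ.posDef z.1 z.2 h).ne' hz
  let w : ℝ → Vec d × Vec d := fun x => (u x, deriv u x)
  have hH : ∀ x, HasDerivAt (lyapunov E S K u) (c * Q (w x)) x :=
    hasDerivAt_lyapunov hE hS hK hu1 hcase hu hM hM'
  obtain ⟨B, hB⟩ := exists_abs_lyapunov_le hE hS hK hu1 hM hM'
  obtain ⟨C, hC⟩ := exists_norm_comp_le (w := w) (M := max M M') hQ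
    fun x => max_le_max (hM x) (hM' x)
  obtain ⟨a, b, ha, hb', hab⟩ :=
    exists_limits_of_bounded_of_deriv_sign hc hH (fun x => hQ0 _) hB
  have hne : ∀ l : Filter ℝ, l.NeBot → (omegaLimit l shift {u}).Nonempty := fun l _ => by
    obtain ⟨v, hv⟩ := exists_mapClusterPt_shift u hb huc l
    exact ⟨v, (mem_omegaLimit_singleton_iff_mapClusterPt _ _ _ _).mpr hv⟩
  -- Stated for a general filter so that it serves both ends; the second conjunct recovers the limit
  -- of the Lyapunov function from the limit point.
  have hlim : ∀ (l : Filter ℝ) [l.IsCountablyGenerated] (e : ℝ),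
      (∀ x, Tendsto (fun τ => x + τ) l l) → Tendsto (lyapunov E S K u) l (𝓝 e) →
      ∀ v ∈ omegaLimit l shift {u}, v.IsConst ∧
        E (v 0, 0) + 1 / 2 * ∫ r, inner ℝ (K r (S (v 0))) (S (v 0)) = e := by
    intro l _ e hl he v hv
    obtain ⟨l', hl', _, _, hj⟩ := exists_filter_of_mapClusterPt
      ((mem_omegaLimit_singleton_iff_mapClusterPt _ _ _ _).mp hv)
    have hj0 := hj 0 (Nat.zero_le _)
    have hj1 := hj 1 hR
    simp only [iteratedDeriv_zero, iteratedDeriv_one] at hj0 hj1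
    have hv1 : ContDiff ℝ 1 v.1 := v.2.of_le (by exact_mod_cast hR)
    have hz := eq_zero_of_tendsto_translates (w := w) (z := fun x => (v x, deriv v x)) hc hQ hQ0
      (hu1.continuous.prodMk (hu1.continuous_deriv le_rfl))
      (hv1.continuous.prodMk (hv1.continuous_deriv le_rfl)) hH hC hl he hl'
      fun x => (hj0 x).prodMk_nhds (hj1 x)
    have hv0 : ∀ x, deriv v x = 0 := fun x => hQ1 _ (hz x)
    have hconst := isConst_of_deriv_eq_zero hR hv0
    refine ⟨hconst, ?_⟩
    obtain ⟨p, hp⟩ := hconst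
    simp only [hv0] at hj1
    simp only [hp] at hj0 ⊢
    exact tendsto_nhds_unique (tendsto_lyapunov hE hS hK hu1 hM hM' hj0 hj1) (he.mono_left hl')
  have hα := hlim atBot a (fun x => tendsto_atBot_add_const_left _ x tendsto_id) ha
  have hω := hlim atTop b (fun x => tendsto_atTop_add_const_left _ x tendsto_id) hb'
  refine ⟨hne _ inferInstance, hne _ inferInstance, fun v hv => (hα v hv).1,
    fun v hv => (hω v hv).1, fun hnc => Set.eq_empty_of_forall_notMem fun v hv => hnc ?_⟩
  -- A common limit point identifies the two limits `a` and `b`.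
  have hzero := hab ((hα v hv.1).2.symm.trans (hω v hv.2).2)
  exact isConst_of_deriv_eq_zero hR fun x => hQ1 _ (hzero x)
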